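/- Theorem. For $n\ge 0$ let $$a(n)=\sum_{k=0}^{n}\binom nk^2\binom{n+k}{k}.$$ (1) The residue of $a(n)$ modulo $9$ is computed by the following base-$3$ automaton. It has states $s_0,s_1,s_2,s_3,s_4$, initial state $s_0$, outputs in $\mathbb Z/9\mathbb Z$, and it reads the standard base-$3$ representation of $n$ beginning with the least significant digit (the representation of $0$ is the empty word). Transitions and outputs are $$\begin{array}{c|ccc|c} \text{state} & 0 & 1 & 2 & \text{output}\\ \hline s_0 & s_0 & s_1 & s_0 & 1\\ s_1 & s_2 & s_3 & s_4 & 3\\ s_2 & s_2 & s_3 & s_2 & 3\\ s_3 & s_3 & s_3 & s_3 & 0\\ s_4 & s_4 & s_3 & s_4 & 6 \end{array}$$ That is, for every $n\ge 0$ the output of the state reached from $s_0$ on the digits of $n$ equals $a(n)\bmod 9$. (2) Explicitly, for every $n\ge 0$: $a(n)\equiv 1 \pmod 9$ if and only if the base-$3$ representation of $n$ contains no digit $1$; $a(n)\equiv 3\pmod 9$ if and only if it contains exactly one digit $1$ and the next more significant digit (if there is one) is not $2$; $a(n)\equiv 6\pmod 9$ if and only if it contains exactly one digit $1$ and the next more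 significant digit is $2$; and $a(n)\equiv 0\pmod 9$ if and only if it contains at least two digits $1$. (3) The generating function $\sum_{n\ge 0}a(n)x^n$ is the diagonal of the expansion in $\mathbb Z[[x_1,x_2,x_3,x_4]]$ of $$\frac{1}{(1-x_1)(1-x_2)(1-x_3)(1-x_4)-(1-x_1)x_1x_2x_3},$$ that is, $a(n)$ is the coefficient of $x_1^nx_2^nx_3^nx_4^n$ in that power series. -/

import Mathlib

/-- A `p`-deterministic finite automaton with output: a finite set `S` of states, the input
alphabet `{0, …, p - 1}`, a transition function, an initial state, a finite output alphabet `A`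
and an output function. -/
structure DFAO (p : ℕ) (S A : Type) [Finite S] [Finite A] where
  /-- the initial state -/
  start : S
  /-- the transition function -/
  step : S → Fin p → S
  /-- the output function -/
  out : S → A

/-- The standard base-`p` representation of `n`, least significant digit first, without leading
zeros; the representation of `0` is the empty word. -/
def baseWord (p : ℕ) [NeZero p] (n : ℕ) : List (Fin p) :=
  (Nat.digits p n).map (Fin.ofNat p)

namespace DFAO

variable {p : ℕ} {S A : Type} [Finite S] [Finite A]

/-- The state reached from `s` after reading a word, the head of the list being read first. -/
def run (M : DFAO p S A) (s : S) (w : List (Fin p)) : S :=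
  w.foldl M.step s

/-- The automaton `M` computes the sequence `a`: fed with the standard base-`p` representation
of `n`, least significant digit first, it outputs `a n`. -/
def Computes [NeZero p] (M : DFAO p S A) (a : ℕ → A) : Prop :=
  ∀ n : ℕ, M.out (M.run M.start (baseWord p n)) = a n

end DFAO

/-- The Apéry numbers for `ζ(2)`. -/
def aperyZetaTwo (n : ℕ) : ℕ :=
  ∑ k ∈ Finset.range (n + 1), n.choose k ^ 2 * (n + k).choose k

/-- The explicit base-3 automaton with five states and outputs in `ℤ/9ℤ`. Row `s` of the table
lists the targets of the edges labelled `0`, `1`, `2` that leave the state `s`. -/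
def aperyZetaTwoAutomaton : DFAO 3 (Fin 5) (ZMod 9) where
  start := 0
  step := ![![0, 1, 0], ![2, 3, 4], ![2, 3, 2], ![3, 3, 3], ![4, 3, 4]]
  out := ![1, 3, 3, 0, 6]

/-- The diagonal of a formal power series in `k` variables: the coefficient of `x ^ n` in the
diagonal is the coefficient of `x₁ ^ n ⋯ x_k ^ n` in the given series. -/
noncomputable def diagonal {k : ℕ} {R : Type} [CommRing R] (f : MvPowerSeries (Fin k) R) :
    PowerSeries R :=
  PowerSeries.mk fun n => MvPowerSeries.coeff (Finsupp.equivFunOnFinite.symm fun _ => n) f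

/-- The polynomial `(1 - x₁)(1 - x₂)(1 - x₃)(1 - x₄) - (1 - x₁) x₁ x₂ x₃`, with `xᵢ₊₁` written
as `X i`. -/
noncomputable def aperyZetaTwoDenom : MvPolynomial (Fin 4) ℤ :=
  (1 - .X 0) * (1 - .X 1) * (1 - .X 2) * (1 - .X 3) - (1 - .X 0) * .X 0 * .X 1 * .X 2

/-- The power series expansion of the reciprocal of `aperyZetaTwoDenom`, whose constant term
is `1`. -/
noncomputable def aperyZetaTwoSeries : MvPowerSeries (Fin 4) ℤ :=
  MvPowerSeries.invOfUnit (aperyZetaTwoDenom : MvPowerSeries (Fin 4) ℤ) 1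

/-- `aperyZetaTwoSeries` is indeed the inverse of `aperyZetaTwoDenom`. -/
theorem aperyZetaTwoDenom_mul_series :
    (aperyZetaTwoDenom : MvPowerSeries (Fin 4) ℤ) * aperyZetaTwoSeries = 1 := by
  apply MvPowerSeries.mul_invOfUnit
  rw [← MvPowerSeries.coeff_zero_eq_constantCoeff_apply, MvPolynomial.coeff_coe,
    ← MvPolynomial.constantCoeff_eq]
  simp [aperyZetaTwoDenom]

/-! Everything modulo 9 follows from a(3m) ≡ a(m), a(3m+1) ≡ (3+6m)a(m), a(3m+2) ≡ a(m). The first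
holds termwise: C(3m,k)² vanishes mod 9 unless 3 ∣ k, and C(3m,3l) ≡ C(m,l). The other two come from
Apéry's three-term recurrence (`aperyZetaTwo_recurrence`), whose leading coefficient is a unit mod 9
at the indices used. Induction on digits then gives the automaton and the digit criterion. For the
diagonal, a geometric series in x₁x₂x₃/((1-x₂)(1-x₃)(1-x₄)) gives the coefficient of x₁^a x₂^b x₃^c
x₄^d as ∑_{k≤a} C(b,k)C(c,k)C(d+k,k); set all exponents to n. -/

/-! ### Binomial coefficients with upper entry 3m -/

theorem Finset.sum_range_three_mul {M : Type*} [AddCommMonoid M] (f : ℕ → M) (n : ℕ) :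
    ∑ i ∈ Finset.range (3 * n), f i =
      ∑ i ∈ Finset.range n, (f (3 * i) + f (3 * i + 1) + f (3 * i + 2)) := by
  induction n with
  | zero => simp
  | succ n ih =>
    rw [Finset.sum_range_succ _ n, ← ih, show 3 * (n + 1) = 3 * n + 1 + 1 + 1 by ring,
      Finset.sum_range_succ, Finset.sum_range_succ, Finset.sum_range_succ]
    simp only [add_assoc]

/-- Multiply (1+x)^(3m) by 1+3x+3x²+x³: in exponents divisible by 3, the two middle terms meet
coefficients already divisible by 3, so they vanish mod 9. -/
theorem three_dvd_choose_and_choose_modEq_nine (m : ℕ) : ∀ l : ℕ,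
    3 ∣ (3 * m).choose (3 * l + 1) ∧ 3 ∣ (3 * m).choose (3 * l + 2) ∧
      (3 * m).choose (3 * l) ≡ m.choose l [MOD 9] := by
  induction m with
  | zero =>
    rintro (_ | l)
    · simp [Nat.ModEq]
    · simp [mul_add, Nat.ModEq]
  | succ m ih =>
    intro l
    rw [show 3 * (m + 1) = 3 * m + 1 + 1 + 1 by ring]
    obtain ⟨h1, h2, h3⟩ := ih l
    have pascal : ∀ j : ℕ, (3 * m + 1 + 1 + 1).choose (j + 3) =
        (3 * m).choose j + 3 * (3 * m).choose (j + 1) + 3 * (3 * m).choose (j + 2)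
          + (3 * m).choose (j + 3) := by
      intro j
      simp only [Nat.choose_succ_succ' _ j, Nat.choose_succ_succ' _ (j + 1),
        Nat.choose_succ_succ' _ (j + 2)]
      ring
    rcases l with _ | l
    · simp only [mul_zero, zero_add, Nat.choose_zero_right, Nat.choose_succ_succ' _ 1,
        Nat.choose_succ_succ' _ 0, Nat.choose_one_right, Nat.reduceAdd, Nat.ModEq.refl, and_true] at h1 h2 ⊢
      omega
    · obtain ⟨g1, g2, g3⟩ := ih l
      have q0 := pascal (3 * l)
      have q1 := pascal (3 * l + 1)
      have q2 := pascal (3 * l + 2)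
      simp only [show 3 * (l + 1) = 3 * l + 3 by ring, add_assoc, Nat.reduceAdd,
        Nat.choose_succ_succ' m l, Nat.ModEq] at *
      omega

/-! ### The three-term recurrence, by creative telescoping -/

/-- The `k`-th summand of `aperyZetaTwo n`. -/
def aperyZetaTwoTerm (n k : ℕ) : ℕ := n.choose k ^ 2 * (n + k).choose k

theorem aperyZetaTwo_eq_sum {n N : ℕ} (h : n < N) :
    aperyZetaTwo n = ∑ k ∈ Finset.range N, aperyZetaTwoTerm n k := by
  refine Finset.sum_subset (Finset.range_subset_range.2 h) fun k _ hk => ?_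
  rw [Nat.choose_eq_zero_of_lt (by simpa using hk)]
  simp

/-- The antidifference in `k` that certifies the recurrence of `aperyZetaTwo`. -/
def aperyZetaTwoCertificate (n k : ℕ) : ℚ :=
  ((k : ℚ) ^ 2 + 3 * (2 * n + 1) * k - 11 * n ^ 2 - 9 * n - 2) * aperyZetaTwoTerm n k

theorem aperyZetaTwoTerm_zero (n : ℕ) : aperyZetaTwoTerm n 0 = 1 := by
  simp [aperyZetaTwoTerm]

theorem cast_succ_sub_mul_choose_succ (n k : ℕ) :
    ((n : ℚ) + 1 - k) * (n + 1).choose k = (n + 1) * n.choose k := by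
  rcases le_or_gt k (n + 1) with h | h
  · have := Nat.choose_mul_succ_eq n k
    have h' : ((n + 1 - k : ℕ) : ℚ) = n + 1 - k := by push_cast [h]; ring
    rw [← h']
    exact_mod_cast by linarith
  · simp [Nat.choose_eq_zero_of_lt h, Nat.choose_eq_zero_of_lt (show n < k by omega)]

/-- The recurrence operator applied to the summand is a difference in k; every binomial involved is
a rational multiple of one product, leaving a polynomial identity. -/
theorem aperyZetaTwoCertificate_succ_sub (m k : ℕ) :
    aperyZetaTwoCertificate (m + 1) (k + 1) - aperyZetaTwoCertificate (m + 1) k =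
      ((m : ℚ) + 2) ^ 2 * aperyZetaTwoTerm (m + 2) (k + 1)
        - (11 * (m : ℚ) ^ 2 + 33 * m + 25) * aperyZetaTwoTerm (m + 1) (k + 1)
        - ((m : ℚ) + 1) ^ 2 * aperyZetaTwoTerm m (k + 1) := by
  have h1 := cast_succ_sub_mul_choose_succ (m + 1) (k + 1)
  have h2 := cast_succ_sub_mul_choose_succ m (k + 1)
  have h3 : (((m + 1 : ℕ) : ℚ) + 1) * (m + 1).choose k = (m + 2).choose (k + 1) * (k + 1) := by
    exact_mod_cast Nat.add_one_mul_choose_eq (m + 1) k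
  have h4 := cast_succ_sub_mul_choose_succ (m + (k + 1)) (k + 1)
  have h5 := cast_succ_sub_mul_choose_succ (m + 1 + (k + 1)) (k + 1)
  have h6 : ((m + 1 + k).choose (k + 1) : ℚ) * (k + 1) = (m + 1 + k).choose k * (m + 1) := by
    have := Nat.choose_succ_right_eq (m + 1 + k) k
    rw [Nat.add_sub_cancel] at this
    exact_mod_cast this
  simp only [aperyZetaTwoCertificate, aperyZetaTwoTerm]
  push_cast at *
  have e1 : m + (k + 1) + 1 = m + 1 + (k + 1) := by ring
  have e2 : m + 1 + (k + 1) + 1 = m + 2 + (k + 1) := by ring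
  have e3 : m + 1 + k = m + (k + 1) := by ring
  rw [e1] at h4
  rw [e2] at h5
  rw [e3] at h6 ⊢
  rw [show m + 1 + 1 = m + 2 by ring] at h1
  have p1 : (m : ℚ) + 1 ≠ 0 := by positivity
  have p2 : (m : ℚ) + 2 ≠ 0 := by positivity
  generalize ((m + 2).choose (k + 1) : ℚ) = x at *
  generalize ((m + 1).choose (k + 1) : ℚ) = x1 at *
  generalize (m.choose (k + 1) : ℚ) = x2 at *
  generalize ((m + 1).choose k : ℚ) = x3 at *
  generalize ((m + (k + 1)).choose (k + 1) : ℚ) = z at *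
  generalize ((m + 1 + (k + 1)).choose (k + 1) : ℚ) = z1 at *
  generalize ((m + 2 + (k + 1)).choose (k + 1) : ℚ) = z2 at *
  generalize ((m + (k + 1)).choose k : ℚ) = z3 at *
  -- Reducing to x and z divides only by m+1 and m+2, never by an expression in k, so no case split
  -- on k is needed.
  obtain rfl : x1 = (m + 1 - k) * x / (m + 2) := by rw [eq_div_iff p2]; linarith
  obtain rfl : x2 = (m - k) * ((m + 1 - k) * x / (m + 2)) / (m + 1) := by
    rw [eq_div_iff p1]; linarith
  obtain rfl : x3 = x * (k + 1) / (m + 2) := by rw [eq_div_iff p2]; linarith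
  obtain rfl : z1 = (m + k + 2) * z / (m + 1) := by rw [eq_div_iff p1]; linarith
  obtain rfl : z2 = (m + k + 3) * ((m + k + 2) * z / (m + 1)) / (m + 2) := by
    rw [eq_div_iff p2]; linarith
  obtain rfl : z3 = z * (k + 1) / (m + 1) := by rw [eq_div_iff p1]; linarith
  field_simp
  ring

theorem aperyZetaTwo_recurrence (m : ℕ) :
    (m + 2) ^ 2 * aperyZetaTwo (m + 2) =
      (11 * m ^ 2 + 33 * m + 25) * aperyZetaTwo (m + 1) + (m + 1) ^ 2 * aperyZetaTwo m := by
  have key : ∀ N : ℕ,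
      ((m : ℚ) + 2) ^ 2 * ∑ k ∈ Finset.range (N + 1), (aperyZetaTwoTerm (m + 2) k : ℚ)
        - (11 * (m : ℚ) ^ 2 + 33 * m + 25) *
          ∑ k ∈ Finset.range (N + 1), (aperyZetaTwoTerm (m + 1) k : ℚ)
        - ((m : ℚ) + 1) ^ 2 * ∑ k ∈ Finset.range (N + 1), (aperyZetaTwoTerm m k : ℚ)
        = aperyZetaTwoCertificate (m + 1) N := by
    intro N
    induction N with
    | zero =>
      simp [aperyZetaTwoTerm_zero, aperyZetaTwoCertificate]
      ring
    | succ N ih =>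
      simp only [Finset.sum_range_succ _ (N + 1)]
      linear_combination ih - aperyZetaTwoCertificate_succ_sub m N
  have h := key (m + 2)
  -- The upper boundary term contains C(m+1, m+2) = 0.
  have h0 : aperyZetaTwoCertificate (m + 1) (m + 2) = 0 := by
    simp [aperyZetaTwoCertificate, aperyZetaTwoTerm]
  rw [h0] at h
  rw [aperyZetaTwo_eq_sum (show m < m + 2 + 1 by omega),
    aperyZetaTwo_eq_sum (show m + 1 < m + 2 + 1 by omega),
    aperyZetaTwo_eq_sum (show m + 2 < m + 2 + 1 by omega)]
  have : (((m + 2) ^ 2 * ∑ k ∈ Finset.range (m + 2 + 1), aperyZetaTwoTerm (m + 2) k : ℕ) : ℚ) =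
      (((11 * m ^ 2 + 33 * m + 25) * ∑ k ∈ Finset.range (m + 2 + 1), aperyZetaTwoTerm (m + 1) k +
        (m + 1) ^ 2 * ∑ k ∈ Finset.range (m + 2 + 1), aperyZetaTwoTerm m k : ℕ) : ℚ) := by
    push_cast
    linear_combination h
  exact_mod_cast this

/-! ### Congruences modulo 9 along residues modulo 3 -/

theorem natCast_nine_eq_zero_of_dvd_sq {c : ℕ} (h : 3 ∣ c) : (c : ZMod 9) ^ 2 = 0 := by
  obtain ⟨d, rfl⟩ := h
  push_cast
  rw [mul_pow, show (3 : ZMod 9) ^ 2 = 0 by decide, zero_mul]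

theorem aperyZetaTwo_three_mul (m : ℕ) :
    (aperyZetaTwo (3 * m) : ZMod 9) = aperyZetaTwo m := by
  rw [aperyZetaTwo_eq_sum (show 3 * m < 3 * (m + 1) by omega),
    aperyZetaTwo_eq_sum (Nat.lt_succ_self m), Finset.sum_range_three_mul]
  push_cast
  refine Finset.sum_congr rfl fun l _ => ?_
  obtain ⟨h1, h2, h3⟩ := three_dvd_choose_and_choose_modEq_nine m l
  have h4 := (three_dvd_choose_and_choose_modEq_nine (m + l) l).2.2
  rw [← ZMod.natCast_eq_natCast_iff] at h3 h4
  simp only [aperyZetaTwoTerm, Nat.cast_mul, Nat.cast_pow, natCast_nine_eq_zero_of_dvd_sq h1,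
    natCast_nine_eq_zero_of_dvd_sq h2, ← mul_add, h3, h4, zero_mul, add_zero]

theorem aperyZetaTwo_three_mul_add_one (m : ℕ) :
    (aperyZetaTwo (3 * m + 1) : ZMod 9) = (3 + 6 * m) * aperyZetaTwo m := by
  rcases m with _ | m
  · decide
  -- Here the coefficient of a(3m+2) is (3m+3)² ≡ 0, so a(3m+4) depends on a(3m+3) alone.
  · have h := congrArg (Nat.cast : ℕ → ZMod 9) (aperyZetaTwo_recurrence (3 * m + 2))
    rw [show 3 * m + 2 + 1 = 3 * (m + 1) by ring,
      show 3 * m + 2 + 2 = 3 * (m + 1) + 1 by ring] at h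
    push_cast [aperyZetaTwo_three_mul] at h ⊢
    generalize (aperyZetaTwo (3 * (m + 1) + 1) : ZMod 9) = y at *
    generalize (aperyZetaTwo (m + 1) : ZMod 9) = x at *
    generalize (aperyZetaTwo (3 * m + 2) : ZMod 9) = z at *
    generalize (m : ZMod 9) = t at *
    have h9 : (9 : ZMod 9) = 0 := by decide
    -- The factor 1+3(t+1) inverts (3t+4)² mod 9; the rest collects multiples of 9.
    linear_combination (1 + 3 * (t + 1)) * h + (-7 * y - 16 * y * t - 12 * y * t ^ 2 - 3 * y * t ^ 3 + 147 * t * x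
      + 11 * t * z + 121 * t ^ 2 * x + 10 * t ^ 2 * z + 33 * t ^ 3 * x + 3 * t ^ 3 * z + 59 * x
      + 4 * z) * h9

theorem aperyZetaTwo_three_mul_add_two (m : ℕ) :
    (aperyZetaTwo (3 * m + 2) : ZMod 9) = aperyZetaTwo m := by
  have h := congrArg (Nat.cast : ℕ → ZMod 9) (aperyZetaTwo_recurrence (3 * m))
  push_cast [aperyZetaTwo_three_mul, aperyZetaTwo_three_mul_add_one] at h
  generalize (aperyZetaTwo (3 * m + 2) : ZMod 9) = y at *
  generalize (aperyZetaTwo m : ZMod 9) = x at *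
  generalize (m : ZMod 9) = t at *
  have h9 : (9 : ZMod 9) = 0 := by decide
  -- The factor 7+6t inverts (3t+2)² mod 9.
  linear_combination (7 + 6 * t) * h + (-3 * y - 12 * y * t - 15 * y * t ^ 2 - 6 * y * t ^ 3 + 403 * t * x
    + 1002 * t ^ 2 * x + 1062 * t ^ 3 * x + 396 * t ^ 4 * x + 59 * x) * h9

/-! ### The automaton and the digit criterion -/

theorem Nat.three_mul_add_induction {P : ℕ → Prop} (zero : P 0)
    (step : ∀ m d, d < 3 → 3 * m + d ≠ 0 → P m → P (3 * m + d)) (n : ℕ) : P n := by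
  induction n using Nat.strong_induction_on with
  | _ n ih =>
    rcases eq_or_ne n 0 with rfl | hn
    · exact zero
    · have h := step (n / 3) (n % 3) (Nat.mod_lt _ (by norm_num))
      rw [Nat.div_add_mod] at h
      exact h hn (ih _ (by omega))

theorem Nat.digits_three_mul_add {m d : ℕ} (hd : d < 3) (h : 3 * m + d ≠ 0) :
    Nat.digits 3 (3 * m + d) = d :: Nat.digits 3 m := by
  rw [add_comm, Nat.digits_add 3 (by norm_num) d m hd (by omega)]

/-- Each state stands for a multiple of a(n), with factors 1, 3+6n, 3, 0, 6; the congruences permute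
these as the table does. All five are needed for the induction. -/
theorem aperyZetaTwoAutomaton_run_baseWord (n : ℕ) :
    (aperyZetaTwoAutomaton.out (aperyZetaTwoAutomaton.run 0 (baseWord 3 n)) = aperyZetaTwo n) ∧
    (aperyZetaTwoAutomaton.out (aperyZetaTwoAutomaton.run 1 (baseWord 3 n)) =
      (3 + 6 * n) * aperyZetaTwo n) ∧
    (aperyZetaTwoAutomaton.out (aperyZetaTwoAutomaton.run 2 (baseWord 3 n)) =
      3 * aperyZetaTwo n) ∧
    (aperyZetaTwoAutomaton.out (aperyZetaTwoAutomaton.run 3 (baseWord 3 n)) = 0) ∧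
    (aperyZetaTwoAutomaton.out (aperyZetaTwoAutomaton.run 4 (baseWord 3 n)) =
      6 * aperyZetaTwo n) := by
  induction n using Nat.three_mul_add_induction with
  | zero => simp [baseWord, DFAO.run]; decide
  | step m d hd hn ih =>
    have hw : baseWord 3 (3 * m + d) = Fin.ofNat 3 d :: baseWord 3 m := by
      simp [baseWord, Nat.digits_three_mul_add hd hn]
    rw [hw]
    simp only [DFAO.run, List.foldl_cons] at ih ⊢
    obtain ⟨i0, i1, i2, i3, i4⟩ := ih
    have h9 : (9 : ZMod 9) = 0 := by decide
    interval_cases d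
    · refine ⟨i0.trans ?_, i2.trans ?_, i2.trans ?_, i3, i4.trans ?_⟩ <;>
        (simp only [add_zero, aperyZetaTwo_three_mul]; try push_cast)
      linear_combination -2 * (m : ZMod 9) * aperyZetaTwo m * h9
    · refine ⟨i1.trans ?_, i3.trans ?_, i3.trans ?_, i3, i3.trans ?_⟩ <;>
        push_cast [aperyZetaTwo_three_mul_add_one]
      · rfl
      · linear_combination -(3 + 12 * (m : ZMod 9) + 12 * (m : ZMod 9) ^ 2) * aperyZetaTwo m * h9
      · linear_combination -(1 + 2 * (m : ZMod 9)) * aperyZetaTwo m * h9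
      · linear_combination -(2 + 4 * (m : ZMod 9)) * aperyZetaTwo m * h9
    · refine ⟨i0.trans ?_, i4.trans ?_, i2.trans ?_, i3, i4.trans ?_⟩ <;>
        push_cast [aperyZetaTwo_three_mul_add_two]
      · rfl
      · linear_combination -(1 + 2 * (m : ZMod 9)) * aperyZetaTwo m * h9
      · rfl
      · rfl

theorem aperyZetaTwo_eq_ite_digits (n : ℕ) :
    (aperyZetaTwo n : ZMod 9) =
      if (Nat.digits 3 n).count 1 = 0 then 1
      else if (Nat.digits 3 n).count 1 = 1 then
        if [1, 2] <:+: Nat.digits 3 n then 6 else 3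
      else 0 := by
  induction n using Nat.three_mul_add_induction with
  | zero => decide
  | step m d hd hn ih =>
    rw [Nat.digits_three_mul_add hd hn]
    have h9 : (9 : ZMod 9) = 0 := by decide
    interval_cases d
    · rw [add_zero, aperyZetaTwo_three_mul, ih]
      simp [List.infix_cons_iff]
    · rw [aperyZetaTwo_three_mul_add_one, ih, List.count_cons_self]
      by_cases h0 : (Nat.digits 3 m).count 1 = 0
      · have h1 : 1 ∉ Nat.digits 3 m := List.count_eq_zero.1 h0
        have h2 : ¬ [1, 2] <:+: Nat.digits 3 m := fun h => h1 (h.subset (by simp))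
        simp only [h0, List.infix_cons_iff, h2, List.cons_prefix_cons, true_and, or_false]
        -- With a(m) ≡ 1, the value is 3+6m, which mod 9 depends only on the next digit m mod 3: 3
        -- for digit 0, 6 for digit 2.
        rcases eq_or_ne m 0 with rfl | hm
        · simp
        · have hd := Nat.digits_three_mul_add (Nat.mod_lt m (show 3 > 0 by norm_num))
            (by rwa [Nat.div_add_mod])
          rw [Nat.div_add_mod] at hd
          have h1' : m % 3 ≠ 1 := fun h => h1 (by rw [hd, h]; simp)
          have hm3 : m % 3 < 3 := Nat.mod_lt _ (by norm_num)
          have hc : (m : ZMod 9) = 3 * (m / 3 : ℕ) + (m % 3 : ℕ) := by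
            exact_mod_cast congrArg (Nat.cast : ℕ → ZMod 9) (Nat.div_add_mod m 3).symm
          have hp : [2] <+: Nat.digits 3 m ↔ m % 3 = 2 := by
            rw [hd, List.cons_prefix_cons]
            simp [eq_comm]
          simp only [hp]
          generalize m % 3 = r at *
          generalize ((m / 3 : ℕ) : ZMod 9) = q at *
          interval_cases r
          · simp [hc]
            linear_combination 2 * q * h9
          · exact absurd rfl h1'
          · simp [hc]
            linear_combination (1 + 2 * q) * h9
      -- A second digit 1: both 3+6m and a(m) are multiples of 3.
      · rw [if_neg h0, if_neg (Nat.succ_ne_zero _),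
          if_neg (show ¬(Nat.digits 3 m).count 1 + 1 = 1 by omega)]
        split_ifs
        · linear_combination (2 + 4 * (m : ZMod 9)) * h9
        · linear_combination (1 + 2 * (m : ZMod 9)) * h9
        · simp
    · rw [aperyZetaTwo_three_mul_add_two, ih]
      simp [List.infix_cons_iff]

/-! ### The diagonal of the rational function -/

namespace MvPowerSeries

theorem coeff_X_mul_eq_ite {σ R : Type*} [Semiring R] (s : σ) (e : σ →₀ ℕ)
    (φ : MvPowerSeries σ R) :
    coeff e (X s * φ) = if e s = 0 then 0 else coeff (e - Finsupp.single s 1) φ := by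
  classical
  rw [X, coeff_monomial_mul, one_mul]
  simp only [Finsupp.single_le_iff, Nat.one_le_iff_ne_zero, ite_not]

end MvPowerSeries

/-- The power series in four variables whose coefficients are given by a function of the four
exponents. -/
def seriesOfCoeffs (c : ℕ → ℕ → ℕ → ℕ → ℤ) : MvPowerSeries (Fin 4) ℤ :=
  fun e => c (e 0) (e 1) (e 2) (e 3)

theorem coeff_seriesOfCoeffs (c : ℕ → ℕ → ℕ → ℕ → ℤ) (e : Fin 4 →₀ ℕ) :
    MvPowerSeries.coeff e (seriesOfCoeffs c) = c (e 0) (e 1) (e 2) (e 3) := rfl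

/-- The coefficient of `x ^ b` in `x ^ a / (1 - x) ^ a`. -/
def shiftedChoose : ℕ → ℕ → ℤ
  | 0, 0 => 1
  | _ + 1, 0 => 0
  | 0, _ + 1 => 0
  | b + 1, a + 1 => b.choose a

/-- The coefficient of `x ^ d` in `1 / (1 - x) ^ a`. -/
def multichooseCoeff : ℕ → ℕ → ℤ
  | 0, 0 => 1
  | _ + 1, 0 => 0
  | d, a + 1 => (d + a).choose a

/-- Coefficientwise form of multiplying x^a/(1-x)^(a+1) by 1-x. -/
theorem shiftedChoose_eq_sub (b a : ℕ) :
    shiftedChoose b a = b.choose a - if b = 0 then 0 else ((b - 1).choose a : ℤ) := by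
  rcases b with _ | b <;> rcases a with _ | a <;> simp [shiftedChoose, Nat.choose_succ_succ']

theorem multichooseCoeff_eq_sub (d a : ℕ) :
    multichooseCoeff d a =
      (d + a).choose a - if d = 0 then 0 else ((d - 1 + a).choose a : ℤ) := by
  rcases d with _ | d <;> rcases a with _ | a <;> simp [multichooseCoeff]
  rw [show d + 1 + (a + 1) = d + a + 1 + 1 by ring, Nat.choose_succ_succ' _ a,
    show d + 1 + a = d + a + 1 by ring]
  push_cast
  ring_nf

open MvPowerSeries in
theorem aperyZetaTwoDenom_mul_seriesOfCoeffs :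
    (aperyZetaTwoDenom : MvPowerSeries (Fin 4) ℤ) *
      seriesOfCoeffs (fun a b c d => ∑ k ∈ Finset.range (a + 1),
        (b.choose k * c.choose k * (d + k).choose k : ℤ)) = 1 := by
  have h0 : (1 - X 0) * seriesOfCoeffs (fun a b c d => ∑ k ∈ Finset.range (a + 1),
        (b.choose k * c.choose k * (d + k).choose k : ℤ)) =
      seriesOfCoeffs fun a b c d => b.choose a * c.choose a * (d + a).choose a := by
    ext e
    rw [sub_mul, one_mul, map_sub, coeff_X_mul_eq_ite]
    simp only [coeff_seriesOfCoeffs, Finsupp.tsub_apply, Finsupp.single_apply]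
    rcases e 0 with _ | a
    · simp
    · simp [Finset.sum_range_succ _ (a + 1)]
  have h1 : (1 - X 1) * seriesOfCoeffs (fun a b c d =>
        b.choose a * c.choose a * (d + a).choose a) =
      seriesOfCoeffs fun a b c d => shiftedChoose b a * c.choose a * (d + a).choose a := by
    ext e
    rw [sub_mul, one_mul, map_sub, coeff_X_mul_eq_ite]
    simp only [coeff_seriesOfCoeffs, Finsupp.tsub_apply, Finsupp.single_apply,
      shiftedChoose_eq_sub]
    split_ifs <;> (simp_all; try ring)
  have h2 : (1 - X 2) * seriesOfCoeffs (fun a b c d =>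
        shiftedChoose b a * c.choose a * (d + a).choose a) =
      seriesOfCoeffs fun a b c d => shiftedChoose b a * shiftedChoose c a * (d + a).choose a := by
    ext e
    rw [sub_mul, one_mul, map_sub, coeff_X_mul_eq_ite]
    simp only [coeff_seriesOfCoeffs, Finsupp.tsub_apply, Finsupp.single_apply,
      shiftedChoose_eq_sub (e 2)]
    split_ifs <;> (simp_all; try ring)
  have h3 : (1 - X 3) * seriesOfCoeffs (fun a b c d =>
        shiftedChoose b a * shiftedChoose c a * (d + a).choose a) =
      seriesOfCoeffs fun a b c d =>
        shiftedChoose b a * shiftedChoose c a * multichooseCoeff d a := by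
    ext e
    rw [sub_mul, one_mul, map_sub, coeff_X_mul_eq_ite]
    simp only [coeff_seriesOfCoeffs, Finsupp.tsub_apply, Finsupp.single_apply,
      multichooseCoeff_eq_sub]
    split_ifs <;> (simp_all; try ring)
  -- With G = (1-x₁)F, this is (1-x₂)(1-x₃)(1-x₄)G = 1 + x₁x₂x₃G, once `h1`, `h2`, `h3` rewrite the
  -- left side.
  have h4 : seriesOfCoeffs (fun a b c d =>
        shiftedChoose b a * shiftedChoose c a * multichooseCoeff d a) =
      1 + X 0 * (X 1 * (X 2 * seriesOfCoeffs (fun a b c d =>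
        b.choose a * c.choose a * (d + a).choose a))) := by
    ext e
    have he : e = 0 ↔ e 0 = 0 ∧ e 1 = 0 ∧ e 2 = 0 ∧ e 3 = 0 := by
      simp [Finsupp.ext_iff, Fin.forall_fin_succ]
    rw [map_add, coeff_one, if_congr he rfl rfl]
    simp only [coeff_X_mul_eq_ite, coeff_seriesOfCoeffs, Finsupp.tsub_apply,
      Finsupp.single_apply]
    rcases e 0 with _ | a <;> rcases e 1 with _ | b <;> rcases e 2 with _ | c <;>
      rcases e 3 with _ | d <;> simp [shiftedChoose, multichooseCoeff]
  have hden : (aperyZetaTwoDenom : MvPowerSeries (Fin 4) ℤ) =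
      (1 - X 0) * (1 - X 1) * (1 - X 2) * (1 - X 3) - (1 - X 0) * X 0 * X 1 * X 2 := by
    simp only [aperyZetaTwoDenom, ← MvPolynomial.coeToMvPowerSeries.ringHom_apply, map_sub,
      map_mul, map_one]
    simp
  rw [hden]
  generalize seriesOfCoeffs (fun a b c d => ∑ k ∈ Finset.range (a + 1),
        (b.choose k * c.choose k * (d + k).choose k : ℤ)) = F at *
  rw [← h3, ← h2, ← h1, ← h0] at h4
  linear_combination h4

theorem aperyZetaTwoSeries_eq_seriesOfCoeffs :
    aperyZetaTwoSeries = seriesOfCoeffs fun a b c d => ∑ k ∈ Finset.range (a + 1),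
      (b.choose k * c.choose k * (d + k).choose k : ℤ) := by
  refine left_inv_eq_right_inv ?_ aperyZetaTwoDenom_mul_seriesOfCoeffs
  rw [mul_comm, aperyZetaTwoDenom_mul_series]

theorem mainTheorem9 :
    aperyZetaTwoAutomaton.Computes (fun n => (aperyZetaTwo n : ZMod 9)) ∧
    (∀ n : ℕ,
      (aperyZetaTwo n ≡ 1 [MOD 9] ↔ 1 ∉ Nat.digits 3 n) ∧
      (aperyZetaTwo n ≡ 3 [MOD 9] ↔
        (Nat.digits 3 n).count 1 = 1 ∧ ¬ [1, 2] <:+: Nat.digits 3 n) ∧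
      (aperyZetaTwo n ≡ 6 [MOD 9] ↔
        (Nat.digits 3 n).count 1 = 1 ∧ [1, 2] <:+: Nat.digits 3 n) ∧
      (aperyZetaTwo n ≡ 0 [MOD 9] ↔ 2 ≤ (Nat.digits 3 n).count 1)) ∧
    PowerSeries.mk (fun n => (aperyZetaTwo n : ℤ)) = diagonal aperyZetaTwoSeries := by
  refine ⟨fun n => (aperyZetaTwoAutomaton_run_baseWord n).1, fun n => ?_, ?_⟩
  · simp only [← ZMod.natCast_eq_natCast_iff, ← List.count_eq_zero, aperyZetaTwo_eq_ite_digits n]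
    generalize (Nat.digits 3 n).count 1 = c
    have h13 : (1 : ZMod 9) ≠ 3 := by decide
    have h16 : (1 : ZMod 9) ≠ 6 := by decide
    have h36 : (3 : ZMod 9) ≠ 6 := by decide
    have h30 : (3 : ZMod 9) ≠ 0 := by decide
    have h60 : (6 : ZMod 9) ≠ 0 := by decide
    have h10 : (1 : ZMod 9) ≠ 0 := by decide
    push_cast
    split_ifs with h0 h1 h2 <;>
      simp [*, h13.symm, h16.symm, h36.symm, h30.symm, h60.symm, h10.symm]
    omega
  · ext n
    rw [aperyZetaTwoSeries_eq_seriesOfCoeffs, diagonal, PowerSeries.coeff_mk,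
      PowerSeries.coeff_mk, coeff_seriesOfCoeffs]
    simp [aperyZetaTwo, sq]
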